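/- Let $C^{1,1}_{\mathrm{ia}}(\mathbb R/\mathbb Z,\mathbb R^3)$ denote the set of injective closed curves $\gamma:\mathbb R/\mathbb Z\to\mathbb R^3$ of class $C^{1,1}$ (that is, $\gamma$ is $C^1$ with Lipschitz continuous derivative) that are parametrized by arclength, $|\gamma'|\equiv1$, equipped with the metric induced by the norm $\|f\|_{C^1}=\sup|f|+\sup|f'|$. For such a curve let $$\mathcal R(\gamma):=\frac{\mathscr L(\gamma)}{\triangle[\gamma]},\qquad \triangle[\gamma]:=\inf_{s\ne t\ne\tau\ne s}R(\gamma(s),\gamma(t),\gamma(\tau)),$$ be its ropelength and thickness, where $\mathscr L(\gamma)=\int_{\mathbb R/\mathbb Z}|\gamma'|\,ds=1$ is the length and $R(x,y,z)\in(0,\infty]$ is the circumradius of three distinct points ($R=\infty$ if they are collinear), and for real $k\ge2$ let $$\mathrm{TP}_k(\gamma):=\iint_{(\mathbb R/\mathbb Z)^2}\frac{1}{r_{\mathrm{tp}}(\gamma(s),\gamma(t))^{k}}\,ds\,dt,\qquad r_{\mathrm{tp}}(\gamma(s),\gamma(t)):=\frac{|\gamma(s)-\gamma(t)|^2}{2\,\mathrm{dist}\big(\gamma(s)+\mathbb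 R\gamma'(s),\gamma(t)\big)},$$ be its tangent-point energy. For every $\gamma\in C^{1,1}_{\mathrm{ia}}(\mathbb R/\mathbb Z,\mathbb R^3)$ one has $(\mathrm{TP}_k(\gamma))^{1/k}\to\mathcal R(\gamma)$ as $k\to\infty$. Moreover, $(\mathrm{TP}_k)^{1/k}$ $\Gamma$-converges to $\mathcal R$ on $\big(C^{1,1}_{\mathrm{ia}}(\mathbb R/\mathbb Z,\mathbb R^3),\|\cdot\|_{C^1}\big)$ as $k\to\infty$; that is, for every sequence of exponents $k_n\to\infty$ and every $\gamma\in C^{1,1}_{\mathrm{ia}}(\mathbb R/\mathbb Z,\mathbb R^3)$: (i) $\mathcal R(\gamma)\le\liminf_{n\to\infty}(\mathrm{TP}_{k_n}(\gamma_n))^{1/k_n}$ for every sequence $(\gamma_n)$ in $C^{1,1}_{\mathrm{ia}}(\mathbb R/\mathbb Z,\mathbb R^3)$ with $\|\gamma_n-\gamma\|_{C^1}\to0$; (ii) there is a sequence $(\gamma_n)$ in $C^{1,1}_{\mathrm{ia}}(\mathbb R/\mathbb Z,\mathbb R^3)$ with $\|\gamma_n-\gamma\|_{C^1}\to0$ and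 $\limsup_{n\to\infty}(\mathrm{TP}_{k_n}(\gamma_n))^{1/k_n}\le\mathcal R(\gamma)$. -/

import Mathlib

open Filter Topology MeasureTheory
open scoped ENNReal NNReal

noncomputable section

namespace TangentPoint

/-- Euclidean three-space. -/
abbrev E3 : Type := EuclideanSpace ℝ (Fin 3)

/-- The derivative `γ'(s)` of a closed curve `γ : ℝ/ℤ → ℝ³` at `s ∈ ℝ/ℤ`. -/
def curveDeriv (γ : UnitAddCircle → E3) (s : UnitAddCircle) : E3 :=
  deriv (fun h : ℝ => γ (s + (h : UnitAddCircle))) 0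

/-- The norm `‖f‖_{C¹} = sup |f| + sup |f'|` (used for `C¹` maps on `ℝ/ℤ`, where both
suprema are finite). -/
def c1Norm (f : UnitAddCircle → E3) : ℝ :=
  (⨆ s, ‖f s‖) + ⨆ s, ‖curveDeriv f s‖

/-- The set of injective closed curves `γ : ℝ/ℤ → ℝ³` of class `C^{1,1}` that are parametrized
by arclength. -/
structure C11ia where
  /-- the underlying map -/
  toFun : UnitAddCircle → E3
  contDiff : ContDiff ℝ 1 (fun x : ℝ => toFun (x : UnitAddCircle))
  lipschitz_deriv : ∃ K : ℝ≥0, LipschitzWith K (curveDeriv toFun)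
  arclength : ∀ s, ‖curveDeriv toFun s‖ = 1
  injective : Function.Injective toFun

/-- The length `∫ |γ'|` of a closed `C¹` curve. -/
def curveLength (γ : UnitAddCircle → E3) : ℝ≥0∞ :=
  ∫⁻ s, ‖curveDeriv γ s‖ₑ

open Classical in
/-- The radius of the circle through three distinct points, with the value `∞` if the points are
collinear. -/
def circumradius (x y z : E3) : ℝ≥0∞ :=
  if h : AffineIndependent ℝ ![x, y, z] then
    ENNReal.ofReal (Affine.Simplex.circumradius (⟨![x, y, z], h⟩ : Affine.Triangle ℝ E3))
  else ⊤

/-- The thickness of a curve: the infimum of the circumradii over all triples of curve points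
with pairwise distinct parameters. -/
def thickness (γ : UnitAddCircle → E3) : ℝ≥0∞ :=
  ⨅ (s : UnitAddCircle) (t : UnitAddCircle) (τ : UnitAddCircle)
    (_ : s ≠ t) (_ : t ≠ τ) (_ : τ ≠ s), circumradius (γ s) (γ t) (γ τ)

/-- Ropelength: the quotient of length and thickness. -/
def ropelength (γ : UnitAddCircle → E3) : ℝ≥0∞ :=
  curveLength γ / thickness γ

/-- The tangent line `γ(s) + ℝ γ'(s)`. -/
def tangentLine (γ : UnitAddCircle → E3) (s : UnitAddCircle) : Set E3 :=
  Set.range fun c : ℝ => γ s + c • curveDeriv γ s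

/-- The tangent-point radius `|γ(s) - γ(t)|² / (2 dist(γ(s) + ℝ γ'(s), γ(t)))`. It is `∞` if
`γ(t) ≠ γ(s)` lies on the tangent line at `γ(s)`. -/
def tpRadius (γ : UnitAddCircle → E3) (s t : UnitAddCircle) : ℝ≥0∞ :=
  edist (γ s) (γ t) ^ 2 / (2 * Metric.infEDist (γ t) (tangentLine γ s))

/-- The tangent-point energy `TP_q(γ)`, the double integral of `1 / r_tp^q` over `(ℝ/ℤ)²`. -/
def TP (q : ℝ) (γ : UnitAddCircle → E3) : ℝ≥0∞ :=
  ∫⁻ p : UnitAddCircle × UnitAddCircle, 1 / tpRadius γ p.1 p.2 ^ q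

/-- `Γ`-convergence of a sequence of functionals on a metric space: the liminf inequality along
every convergent sequence, and the existence of recovery sequences. -/
def GammaConverges {X : Type*} [MetricSpace X] (F : ℕ → X → ℝ≥0∞) (F' : X → ℝ≥0∞) : Prop :=
  (∀ (x : X) (u : ℕ → X), Tendsto u atTop (𝓝 x) →
      F' x ≤ liminf (fun n => F n (u n)) atTop) ∧
  (∀ x : X, ∃ u : ℕ → X, Tendsto u atTop (𝓝 x) ∧
      limsup (fun n => F n (u n)) atTop ≤ F' x)

namespace C11ia

theorem curveDeriv_coe (f : UnitAddCircle → E3) (x : ℝ) :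
    curveDeriv f (x : UnitAddCircle) = deriv (fun y : ℝ => f (y : UnitAddCircle)) x := by
  have h := deriv_comp_const_add (f := fun y : ℝ => f (y : UnitAddCircle)) x 0
  rw [add_zero] at h
  rw [← h]
  simp [curveDeriv]

theorem continuous_toFun (γ : C11ia) : Continuous γ.toFun :=
  (QuotientAddGroup.isQuotientMap_mk (N := AddSubgroup.zmultiples (1 : ℝ))).continuous_iff.2
    γ.contDiff.continuous

theorem continuous_curveDeriv (γ : C11ia) : Continuous (curveDeriv γ.toFun) :=
  γ.lipschitz_deriv.choose_spec.continuous

theorem curveDeriv_sub (γ β : C11ia) :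
    curveDeriv (γ.toFun - β.toFun) = curveDeriv γ.toFun - curveDeriv β.toFun := by
  funext s
  induction s using QuotientAddGroup.induction_on with
  | H x =>
    have h1 := (γ.contDiff.differentiable one_ne_zero) x
    have h2 := (β.contDiff.differentiable one_ne_zero) x
    have h := curveDeriv_coe (γ.toFun - β.toFun) x
    have hγ := curveDeriv_coe γ.toFun x
    have hβ := curveDeriv_coe β.toFun x
    have e := deriv_fun_sub h1 h2
    exact h.trans (e.trans (congrArg₂ (· - ·) hγ.symm hβ.symm))

/-- The pair `(γ, γ')` of continuous maps on the compact space `ℝ/ℤ`. -/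
def jet (γ : C11ia) : C(UnitAddCircle, E3) × C(UnitAddCircle, E3) :=
  (⟨γ.toFun, γ.continuous_toFun⟩, ⟨curveDeriv γ.toFun, γ.continuous_curveDeriv⟩)

theorem c1Norm_sub (γ β : C11ia) :
    c1Norm (γ.toFun - β.toFun) =
      dist γ.jet.1 β.jet.1 + dist γ.jet.2 β.jet.2 := by
  rw [c1Norm, curveDeriv_sub, dist_eq_norm, dist_eq_norm, ContinuousMap.norm_eq_iSup_norm,
    ContinuousMap.norm_eq_iSup_norm]
  rfl

/-- The metric `‖γ - β‖_{C¹}`. -/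
instance : MetricSpace C11ia where
  dist γ β := c1Norm (γ.toFun - β.toFun)
  dist_self γ := by rw [c1Norm_sub]; simp
  dist_comm γ β := by rw [c1Norm_sub, c1Norm_sub]; simp [dist_comm]
  dist_triangle α β γ := by
    rw [c1Norm_sub, c1Norm_sub, c1Norm_sub]
    linarith [dist_triangle α.jet.1 β.jet.1 γ.jet.1, dist_triangle α.jet.2 β.jet.2 γ.jet.2]
  eq_of_dist_eq_zero := by
    intro γ β h
    rw [c1Norm_sub] at h
    have h0 : dist γ.jet.1 β.jet.1 = 0 := by
      linarith [dist_nonneg (x := γ.jet.1) (y := β.jet.1),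
        dist_nonneg (x := γ.jet.2) (y := β.jet.2)]
    have h1 : γ.toFun = β.toFun := congrArg DFunLike.coe (eq_of_dist_eq_zero h0)
    cases γ
    cases β
    simpa using h1

end C11ia

end TangentPoint

end

/-! Since the length is 1, the ropelength is the reciprocal thickness, and this equals the supremum
of the reciprocal tangent-point radius over off-diagonal pairs (`inv_le_thickness`,
`ofReal_tpCurvature_le`). One inequality lets two points of a triple merge; the other shows that a
sphere smaller than all tangent-point radii cannot meet the curve three times.

The rest compares an `L^k` norm with a supremum. As `(ℝ/ℤ)²` has measure 1, each root is at most the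
ropelength (`TP_rpow_le`), so constant recovery sequences suffice. Conversely, the reciprocal radius
is jointly continuous in curve and parameters off the diagonal, so a value above `M` persists on a
fixed open set `O` for all nearby curves. This bounds the root below by `M * volume O ^ (1/k)`,
which tends to `M`. -/

namespace TangentPoint

/-! ### Orthogonal components and tangent-point curvature -/

/-- The component of `z` orthogonal to the unit vector `v`. -/
noncomputable def rejection (v z : E3) : E3 := z - inner ℝ v z • v

theorem continuous_rejection : Continuous fun p : E3 × E3 => rejection p.1 p.2 := by
  unfold rejection
  fun_prop

theorem norm_rejection_sq {v : E3} (hv : ‖v‖ = 1) (z : E3) :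
    ‖rejection v z‖ ^ 2 = ‖z‖ ^ 2 - inner ℝ v z ^ 2 := by
  rw [rejection, norm_sub_sq_real, norm_smul, real_inner_smul_right, hv, real_inner_comm,
    mul_one, Real.norm_eq_abs, sq_abs]
  ring

theorem norm_rejection_le {v : E3} (hv : ‖v‖ = 1) (z : E3) (c : ℝ) :
    ‖rejection v z‖ ≤ ‖z - c • v‖ := by
  refine le_of_sq_le_sq ?_ (norm_nonneg _)
  rw [norm_rejection_sq hv, norm_sub_sq_real, norm_smul, real_inner_smul_right, hv,
    real_inner_comm, mul_one, Real.norm_eq_abs, sq_abs]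
  nlinarith [sq_nonneg (inner ℝ z v - c)]

theorem sin_angle_eq_norm_rejection_div {v : E3} (hv : ‖v‖ = 1) {z : E3} (hz : z ≠ 0) :
    Real.sin (InnerProductGeometry.angle v z) = ‖rejection v z‖ / ‖z‖ := by
  have h := InnerProductGeometry.sin_angle_mul_norm_mul_norm v z
  rw [real_inner_self_eq_norm_sq, real_inner_self_eq_norm_sq, hv, one_mul, one_pow, one_mul,
    ← sq, ← norm_rejection_sq hv, Real.sqrt_sq (norm_nonneg _)] at h
  rw [eq_div_iff (norm_ne_zero_iff.2 hz), h]

/-- The reciprocal of the tangent-point radius, as a real number. -/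
noncomputable def tpCurvature (γ : UnitAddCircle → E3) (s t : UnitAddCircle) : ℝ :=
  2 * ‖rejection (curveDeriv γ s) (γ t - γ s)‖ / ‖γ t - γ s‖ ^ 2

theorem tpCurvature_nonneg (γ : UnitAddCircle → E3) (s t : UnitAddCircle) :
    0 ≤ tpCurvature γ s t := by
  unfold tpCurvature
  positivity

namespace C11ia

variable (γ : C11ia)

theorem infEDist_tangentLine (s : UnitAddCircle) (y : E3) :
    Metric.infEDist y (tangentLine γ.toFun s) =
      ENNReal.ofReal ‖rejection (curveDeriv γ.toFun s) (y - γ.toFun s)‖ := by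
  apply le_antisymm
  · refine (Metric.infEDist_le_edist_of_mem
      (Set.mem_range_self (inner ℝ (curveDeriv γ.toFun s) (y - γ.toFun s)))).trans_eq ?_
    rw [edist_dist, dist_eq_norm, rejection, sub_sub]
  · rw [Metric.le_infEDist]
    rintro _ ⟨c, rfl⟩
    rw [edist_dist, dist_eq_norm, ← sub_sub]
    exact ENNReal.ofReal_le_ofReal (norm_rejection_le (γ.arclength s) _ _)

/-- This fails on the diagonal: there `0 / 0 = 0` makes the left side `⊤`, while the curvature is
`0`. -/
theorem inv_tpRadius {s t : UnitAddCircle} (h : s ≠ t) :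
    (tpRadius γ.toFun s t)⁻¹ = ENNReal.ofReal (tpCurvature γ.toFun s t) := by
  have hne : γ.toFun t - γ.toFun s ≠ 0 := sub_ne_zero.2 (γ.injective.ne h.symm)
  have hpos : 0 < ‖γ.toFun t - γ.toFun s‖ ^ 2 := by positivity
  rw [tpRadius, infEDist_tangentLine, edist_comm, edist_dist, dist_eq_norm,
    ← ENNReal.ofReal_pow (norm_nonneg _), ENNReal.inv_div (.inr ENNReal.ofReal_ne_top)
      (.inr (ENNReal.ofReal_pos.2 hpos).ne'), tpCurvature, ENNReal.ofReal_div_of_pos hpos,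
    ENNReal.ofReal_mul zero_le_two, ENNReal.ofReal_ofNat]

theorem hasDerivAt (x : ℝ) :
    HasDerivAt (fun y : ℝ => γ.toFun (y : UnitAddCircle))
      (curveDeriv γ.toFun (x : UnitAddCircle)) x := by
  rw [curveDeriv_coe]
  exact ((γ.contDiff.differentiable one_ne_zero) x).hasDerivAt

/-! ### Small spheres meet the curve at most twice -/

theorem hasDerivAt_norm_sub_sq (c : E3) (x : ℝ) :
    HasDerivAt (fun y : ℝ => ‖γ.toFun (y : UnitAddCircle) - c‖ ^ 2)
      (2 * inner ℝ (γ.toFun (x : UnitAddCircle) - c)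
        (curveDeriv γ.toFun (x : UnitAddCircle))) x :=
  ((γ.hasDerivAt x).sub_const c).norm_sq

/-- If the tangent-point radii are at least `δ`, a critical point of the distance to `c` at which
the distance is less than `δ` is the only global minimum point of that distance. -/
theorem norm_sub_lt_of_inner_eq_zero {δ : ℝ} (hδ : 0 < δ)
    (h : ∀ s t, s ≠ t → tpCurvature γ.toFun s t ≤ δ⁻¹) {c : E3} {s t : UnitAddCircle}
    (hst : s ≠ t) (hc : inner ℝ (γ.toFun s - c) (curveDeriv γ.toFun s) = 0)
    (hlt : ‖γ.toFun s - c‖ < δ) : ‖γ.toFun s - c‖ < ‖γ.toFun t - c‖ := by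
  have hk := h s t hst
  have hne : γ.toFun t - γ.toFun s ≠ 0 := sub_ne_zero.2 (γ.injective.ne hst.symm)
  have hpos : 0 < ‖γ.toFun t - γ.toFun s‖ ^ 2 := by positivity
  rw [tpCurvature, div_le_iff₀ hpos, inv_mul_eq_div, le_div_iff₀ hδ] at hk
  have hsum : γ.toFun t - c = (γ.toFun t - γ.toFun s) + (γ.toFun s - c) := by abel
  generalize γ.toFun t - γ.toFun s = z at *
  generalize γ.toFun s - c = u at *
  generalize curveDeriv γ.toFun s = v at *
  -- As `u ⟂ v`, only the rejection of `z` enters the cross term of `‖z + u‖²`; the curvature bound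
  -- and `‖u‖ < δ` make that term smaller than `‖z‖²`.
  have hin : inner ℝ z u = inner ℝ (rejection v z) u := by
    rw [rejection, inner_sub_left, real_inner_smul_left, real_inner_comm u v, hc]
    ring
  have habs := (abs_le.1 (abs_real_inner_le_norm (rejection v z) u)).1
  rw [← hin] at habs
  refine lt_of_pow_lt_pow_left₀ 2 (norm_nonneg _) ?_
  rw [hsum, norm_add_sq_real]
  have h1 : δ * (2 * (‖rejection v z‖ * ‖u‖)) < δ * ‖z‖ ^ 2 := by
    calc δ * (2 * (‖rejection v z‖ * ‖u‖)) = (2 * ‖rejection v z‖ * δ) * ‖u‖ := by ring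
      _ ≤ ‖z‖ ^ 2 * ‖u‖ := by gcongr
      _ < ‖z‖ ^ 2 * δ := by gcongr
      _ = δ * ‖z‖ ^ 2 := mul_comm _ _
  have h2 := lt_of_mul_lt_mul_left h1 hδ.le
  linarith

end C11ia

/-- If the minimum over `[a, c]` is attained at an endpoint, the equal values make `b` an interior
minimum as well. -/
theorem exists_isLocalMin_of_eq_of_eq {f : ℝ → ℝ} (hf : Continuous f) {a b c : ℝ} (hab : a < b)
    (hbc : b < c) (h1 : f a = f b) (h2 : f c = f b) :
    ∃ m ∈ Set.Ioo a c, IsLocalMin f m ∧ f m ≤ f b := by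
  obtain ⟨m, hm, hmin⟩ := isCompact_Icc.exists_isMinOn
    (Set.nonempty_Icc.2 (hab.trans hbc).le) hf.continuousOn
  have key : ∀ m ∈ Set.Ioo a c, IsMinOn f (Set.Icc a c) m →
      ∃ m ∈ Set.Ioo a c, IsLocalMin f m ∧ f m ≤ f b := fun m hm hmin =>
    ⟨m, hm, hmin.isLocalMin (Icc_mem_nhds hm.1 hm.2), hmin ⟨hab.le, hbc.le⟩⟩
  have hend : f m = f b → ∃ m ∈ Set.Ioo a c, IsLocalMin f m ∧ f m ≤ f b := fun h =>
    key b ⟨hab, hbc⟩ fun y hy => h ▸ hmin hy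
  rcases eq_or_lt_of_le hm.1 with rfl | ha
  · exact hend h1
  rcases eq_or_lt_of_le hm.2 with rfl | hc
  · exact hend h2
  exact key m ⟨ha, hc⟩ hmin

theorem exists_isLocalMin_of_pairwise_ne {f : ℝ → ℝ} (hf : Continuous f) {l u r a b c : ℝ}
    (ha : a ∈ Set.Ioo l u) (hb : b ∈ Set.Ioo l u) (hc : c ∈ Set.Ioo l u) (hab : a ≠ b)
    (hbc : b ≠ c) (hca : c ≠ a) (h1 : f a = r) (h2 : f b = r) (h3 : f c = r) :
    ∃ m ∈ Set.Ioo l u, IsLocalMin f m ∧ f m ≤ r := by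
  have key : ∀ x ∈ Set.Ioo l u, ∀ y, ∀ z ∈ Set.Ioo l u, x < y → y < z →
      f x = r → f y = r → f z = r → ∃ m ∈ Set.Ioo l u, IsLocalMin f m ∧ f m ≤ r := by
    intro x hx y z hz hxy hyz ex ey ez
    obtain ⟨m, hm, hloc, hle⟩ :=
      exists_isLocalMin_of_eq_of_eq hf hxy hyz (ex.trans ey.symm) (ez.trans ey.symm)
    exact ⟨m, ⟨hx.1.trans hm.1, hm.2.trans hz.2⟩, hloc, hle.trans_eq ey⟩
  rcases hab.lt_or_gt with h | h <;> rcases hbc.lt_or_gt with h' | h' <;>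
    rcases hca.lt_or_gt with h'' | h''
  · exact absurd (h.trans (h'.trans h'')) (lt_irrefl _)
  · exact key a ha b c hc h h' h1 h2 h3
  · exact key c hc a b hb h'' h h3 h1 h2
  · exact key a ha c b hb h'' h' h1 h3 h2
  · exact key b hb c a ha h' h'' h2 h3 h1
  · exact key b hb a c hc h h'' h2 h1 h3
  · exact key c hc b a ha h' h h3 h2 h1
  · exact absurd (h.trans (h''.trans h')) (lt_irrefl _)

namespace C11ia

variable (γ : C11ia)

/-- If the tangent-point radii are at least `δ`, no sphere of radius less than `δ` meets the curve
in three points. -/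
theorem not_three_points_on_sphere {δ : ℝ} (hδ : 0 < δ)
    (h : ∀ s t, s ≠ t → tpCurvature γ.toFun s t ≤ δ⁻¹) {c : E3} {R : ℝ} (hR : R < δ)
    {s t τ : UnitAddCircle} (hst : s ≠ t) (htτ : t ≠ τ) (hτs : τ ≠ s)
    (h1 : ‖γ.toFun s - c‖ = R) (h2 : ‖γ.toFun t - c‖ = R) (h3 : ‖γ.toFun τ - c‖ = R) : False := by
  set f : ℝ → ℝ := fun y => ‖γ.toFun (y : UnitAddCircle) - c‖ ^ 2 with hf
  have hcont : Continuous f := by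
    have := γ.contDiff.continuous
    fun_prop
  have crit : ∀ x : ℝ, IsLocalMin f x → ‖γ.toFun x - c‖ ≤ R →
      ∀ p : UnitAddCircle, (x : UnitAddCircle) ≠ p → ‖γ.toFun x - c‖ < ‖γ.toFun p - c‖ := by
    intro x hx hle p hp
    have h0 := hx.hasDerivAt_eq_zero (γ.hasDerivAt_norm_sub_sq c x)
    exact γ.norm_sub_lt_of_inner_eq_zero hδ h hp (by linarith) (hle.trans_lt hR)
  obtain ⟨q, -, hq⟩ := isCompact_univ.exists_isMinOn (Set.univ_nonempty (α := UnitAddCircle))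
    (γ.continuous_toFun.sub continuous_const : Continuous fun p => γ.toFun p - c).norm.continuousOn
  have hq' : ∀ p, ‖γ.toFun q - c‖ ≤ ‖γ.toFun p - c‖ := fun p => hq (Set.mem_univ p)
  obtain ⟨x₀, rfl⟩ := QuotientAddGroup.mk_surjective q
  have hmin : IsLocalMin f x₀ :=
    Filter.Eventually.of_forall fun y => pow_le_pow_left₀ (norm_nonneg _) (hq' y) 2
  have hqlt := crit x₀ hmin ((hq' s).trans_eq h1)
  -- At least one of `s`, `t` differs from the minimum point, and the minimum is strict.
  have hqR : ‖γ.toFun (x₀ : UnitAddCircle) - c‖ < R := by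
    by_cases hs : (x₀ : UnitAddCircle) = s
    · exact (hqlt t (hs ▸ hst)).trans_eq h2
    · exact (hqlt s hs).trans_eq h1
  -- Cutting the circle at the global minimum puts all three points in one open interval, which
  -- yields a second local minimum, at height at most `R`. Each of the two would be strictly below
  -- the other.
  have lift : ∀ p : UnitAddCircle, ‖γ.toFun p - c‖ = R →
      ∃ x ∈ Set.Ioo x₀ (x₀ + 1), (x : UnitAddCircle) = p := by
    intro p hp
    obtain ⟨x, hx, rfl⟩ : p ∈ ((↑) : ℝ → UnitAddCircle) '' Set.Ico x₀ (x₀ + 1) := by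
      rw [AddCircle.coe_image_Ico_eq]; trivial
    refine ⟨x, ⟨lt_of_le_of_ne hx.1 ?_, hx.2⟩, rfl⟩
    rintro rfl
    exact hqR.ne hp
  obtain ⟨a, ha, rfl⟩ := lift s h1
  obtain ⟨b, hb, rfl⟩ := lift t h2
  obtain ⟨d, hd, rfl⟩ := lift τ h3
  obtain ⟨m, hm, hloc, hle⟩ := exists_isLocalMin_of_pairwise_ne (r := R ^ 2) hcont ha hb hd
    (fun e => hst (by rw [e])) (fun e => htτ (by rw [e])) (fun e => hτs (by rw [e]))
    (by rw [hf, ← h1]) (by rw [hf, ← h2]) (by rw [hf, ← h3])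
  have hmR : ‖γ.toFun m - c‖ ≤ R :=
    le_of_sq_le_sq hle (h1 ▸ norm_nonneg _)
  have hne : (m : UnitAddCircle) ≠ x₀ := fun e => hm.1.ne'
    ((AddCircle.coe_eq_coe_iff_of_mem_Ico (p := (1 : ℝ)) (a := x₀) ⟨hm.1.le, hm.2⟩
      ⟨le_rfl, by linarith⟩).1 e)
  exact (crit m hloc hmR x₀ hne).not_ge (hq' m)

/-- A circumradius below `M⁻¹` would leave room for a finite `δ` in between, and the sphere about
the circumcenter would contradict `not_three_points_on_sphere`. -/
theorem inv_le_thickness {M : ℝ≥0∞}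
    (h : ∀ s t, s ≠ t → ENNReal.ofReal (tpCurvature γ.toFun s t) ≤ M) :
    M⁻¹ ≤ thickness γ.toFun := by
  refine le_iInf fun s => le_iInf fun t => le_iInf fun τ => le_iInf fun hst => le_iInf fun htτ =>
    le_iInf fun hτs => ?_
  unfold circumradius
  split_ifs with hind
  swap
  · exact le_top
  by_contra! hlt
  obtain ⟨δ, hRδ, hδM⟩ := ENNReal.lt_iff_exists_nnreal_btwn.1 hlt
  set T : Affine.Triangle ℝ E3 := ⟨![γ.toFun s, γ.toFun t, γ.toFun τ], hind⟩ with hT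
  have hδ : 0 < (δ : ℝ) := by
    have : (0 : ℝ≥0∞) < δ := (zero_le).trans_lt hRδ
    exact_mod_cast this
  rw [← ENNReal.ofReal_coe_nnreal, ENNReal.ofReal_lt_ofReal_iff hδ] at hRδ
  have hd := T.dist_circumcenter_eq_circumradius
  refine γ.not_three_points_on_sphere hδ (fun u v huv => ?_) hRδ hst htτ hτs (c := T.circumcenter)
    (by simpa [hT, dist_eq_norm] using hd 0) (by simpa [hT, dist_eq_norm] using hd 1)
    (by simpa [hT, dist_eq_norm] using hd 2)
  have h1 : ENNReal.ofReal (tpCurvature γ.toFun u v) ≤ (δ : ℝ≥0∞)⁻¹ :=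
    (h u v huv).trans (ENNReal.le_inv_iff_le_inv.1 hδM.le)
  rw [← ENNReal.ofReal_coe_nnreal, ← ENNReal.ofReal_inv_of_pos hδ] at h1
  exact (ENNReal.ofReal_le_ofReal_iff (inv_nonneg.2 hδ.le)).1 h1

end C11ia

/-! ### Tangent-point radii as limits of circumradii -/

theorem circumradius_eq_of_sin_angle_ne_zero {x y z : E3} (hxy : x ≠ y) (hzy : z ≠ y)
    (h : Real.sin (EuclideanGeometry.angle x y z) ≠ 0) :
    circumradius x y z =
      ENNReal.ofReal (dist x z / Real.sin (EuclideanGeometry.angle x y z) / 2) := by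
  have hind : AffineIndependent ℝ ![x, y, z] := by
    rw [affineIndependent_iff_not_collinear_set,
      EuclideanGeometry.collinear_iff_eq_or_eq_or_sin_eq_zero]
    tauto
  rw [circumradius, dif_pos hind]
  congr 1
  exact (Affine.Triangle.dist_div_sin_angle_div_two_eq_circumradius
    (⟨![x, y, z], hind⟩ : Affine.Triangle ℝ E3) (i₁ := 0) (i₂ := 1) (i₃ := 2)
    (by decide) (by decide) (by decide)).symm

namespace C11ia

variable (γ : C11ia)

/-- By the law of sines, the circumradius of `γ(s+h)`, `γ(s)`, `γ(t)` tends to the tangent-point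
radius as `h → 0⁺`. Zero curvature is treated apart, since the sine in the denominator would vanish.
-/
theorem ofReal_tpCurvature_le {s t : UnitAddCircle} (hst : s ≠ t) :
    ENNReal.ofReal (tpCurvature γ.toFun s t) ≤ (thickness γ.toFun)⁻¹ := by
  rcases (tpCurvature_nonneg γ.toFun s t).eq_or_lt with h0 | hpos
  · simp [← h0]
  have hne : γ.toFun t - γ.toFun s ≠ 0 := sub_ne_zero.2 (γ.injective.ne hst.symm)
  have hv : curveDeriv γ.toFun s ≠ 0 := norm_ne_zero_iff.1 (by rw [γ.arclength]; exact one_ne_zero)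
  have hsin := sin_angle_eq_norm_rejection_div (γ.arclength s) hne
  have hrej : 0 < ‖rejection (curveDeriv γ.toFun s) (γ.toFun t - γ.toFun s)‖ := by
    rw [norm_pos_iff]
    intro h
    simp [tpCurvature, h] at hpos
  have hsin0 : Real.sin (InnerProductGeometry.angle (curveDeriv γ.toFun s)
      (γ.toFun t - γ.toFun s)) ≠ 0 := by
    rw [hsin]
    exact div_ne_zero hrej.ne' (norm_ne_zero_iff.2 hne)
  obtain ⟨x, rfl⟩ := QuotientAddGroup.mk_surjective s
  set σ : UnitAddCircle := QuotientAddGroup.mk x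
  set τ : ℝ → UnitAddCircle := fun h => ((x + h : ℝ) : UnitAddCircle) with hτ
  have hslope : Tendsto (fun h : ℝ => h⁻¹ • (γ.toFun (τ h) - γ.toFun σ)) (𝓝[>] 0)
      (𝓝 (curveDeriv γ.toFun σ)) := (γ.hasDerivAt x).tendsto_slope_zero_right
  have hang : Tendsto (fun h : ℝ => Real.sin
      (EuclideanGeometry.angle (γ.toFun (τ h)) (γ.toFun σ) (γ.toFun t))) (𝓝[>] 0)
      (𝓝 (Real.sin (InnerProductGeometry.angle (curveDeriv γ.toFun σ)
        (γ.toFun t - γ.toFun σ)))) := by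
    have h1 := (InnerProductGeometry.continuousAt_angle
      (x := (curveDeriv γ.toFun σ, γ.toFun t - γ.toFun σ)) hv hne).tendsto.comp
        (hslope.prodMk_nhds (tendsto_const_nhds (x := γ.toFun t - γ.toFun σ)))
    refine ((Real.continuous_sin.tendsto _).comp h1).congr' ?_
    filter_upwards [self_mem_nhdsWithin] with h hh
    simp only [Function.comp_apply, EuclideanGeometry.angle, vsub_eq_sub]
    -- The limit is one-sided because only a positive factor `h⁻¹` preserves the angle.
    rw [InnerProductGeometry.angle_smul_left_of_pos _ _ (inv_pos.2 hh)]
  have hγτ : Tendsto (fun h : ℝ => γ.toFun (τ h)) (𝓝[>] 0) (𝓝 (γ.toFun σ)) := by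
    have hc : Continuous fun h : ℝ => γ.toFun (τ h) :=
      γ.contDiff.continuous.comp (continuous_const.add continuous_id)
    have := hc.tendsto 0
    simp only [hτ, add_zero] at this
    exact this.mono_left nhdsWithin_le_nhds
  have hdist : Tendsto (fun h : ℝ => dist (γ.toFun (τ h)) (γ.toFun t)) (𝓝[>] 0)
      (𝓝 ‖γ.toFun t - γ.toFun σ‖) := by
    rw [← dist_eq_norm, dist_comm]
    exact hγτ.dist tendsto_const_nhds
  have hlim := ENNReal.tendsto_ofReal ((hdist.div hang hsin0).div_const 2)
  have hle : thickness γ.toFun ≤ ENNReal.ofReal ((tpCurvature γ.toFun σ t)⁻¹) := by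
    have hval : ‖γ.toFun t - γ.toFun σ‖ / Real.sin (InnerProductGeometry.angle
        (curveDeriv γ.toFun σ) (γ.toFun t - γ.toFun σ)) / 2 = (tpCurvature γ.toFun σ t)⁻¹ := by
      rw [hsin, tpCurvature]
      have := norm_pos_iff.2 hne
      field_simp
    rw [← hval]
    refine ge_of_tendsto hlim ?_
    filter_upwards [hang.eventually_ne hsin0, hslope.eventually_ne hv,
      hγτ.eventually_ne (γ.injective.ne hst)] with h h1 h2 h3
    have h4 : τ h ≠ σ := fun e => h2 (by rw [e, sub_self, smul_zero])
    have h5 : t ≠ τ h := fun e => h3 (by rw [e])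
    simp only [Pi.div_apply]
    rw [← circumradius_eq_of_sin_angle_ne_zero (γ.injective.ne h4) (γ.injective.ne hst.symm) h1]
    exact iInf_le_of_le (τ h) <| iInf_le_of_le σ <| iInf_le_of_le t <| iInf_le_of_le h4 <|
      iInf_le_of_le hst <| iInf_le _ h5
  rw [ENNReal.le_inv_iff_le_inv, ← ENNReal.ofReal_inv_of_pos hpos]
  exact hle

/-! ### Upper bound for the energies -/

theorem ropelength_eq : ropelength γ.toFun = (thickness γ.toFun)⁻¹ := by
  have h : curveLength γ.toFun = 1 := by
    have he : ∀ s, ‖curveDeriv γ.toFun s‖ₑ = 1 := fun s => by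
      rw [← ofReal_norm, γ.arclength, ENNReal.ofReal_one]
    simp only [curveLength, he, lintegral_const, UnitAddCircle.measure_univ, mul_one]
  rw [ropelength, h, one_div]

theorem exists_lt_tpCurvature {M : ℝ≥0∞} (hM : M < ropelength γ.toFun) :
    ∃ s t, s ≠ t ∧ M < ENNReal.ofReal (tpCurvature γ.toFun s t) := by
  by_contra! h
  rw [ropelength_eq] at hM
  exact (ENNReal.inv_le_inv.1 (by simpa using γ.inv_le_thickness h)).not_gt hM

theorem one_div_tpRadius_rpow {s t : UnitAddCircle} (hst : s ≠ t) (q : ℝ) :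
    1 / tpRadius γ.toFun s t ^ q = ENNReal.ofReal (tpCurvature γ.toFun s t) ^ q := by
  rw [one_div, ← ENNReal.inv_rpow, γ.inv_tpRadius hst]

theorem volume_univ_circle_prod :
    volume (Set.univ : Set (UnitAddCircle × UnitAddCircle)) = 1 := by
  rw [← Set.univ_prod_univ, Measure.volume_eq_prod, Measure.prod_prod,
    UnitAddCircle.measure_univ, one_mul]

/-- Makes the conventional value of the integrand on the diagonal irrelevant. -/
theorem ae_fst_ne_snd : ∀ᵐ p : UnitAddCircle × UnitAddCircle, p.1 ≠ p.2 := by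
  have h : volume (Set.diagonal UnitAddCircle) = 0 := by
    rw [Measure.volume_eq_prod, Measure.measure_prod_null measurableSet_diagonal]
    refine Filter.Eventually.of_forall fun x => ?_
    have : Prod.mk x ⁻¹' Set.diagonal UnitAddCircle = {x} := by
      ext y; simp [eq_comm]
    simpa [this] using AddCircle.volume_closedBall (T := 1) (x := x) 0
  exact measure_eq_zero_iff_ae_notMem.1 h

theorem TP_rpow_le {q : ℝ} (hq : 0 < q) : TP q γ.toFun ^ (1 / q) ≤ ropelength γ.toFun := by
  have h : TP q γ.toFun ≤ ropelength γ.toFun ^ q := by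
    calc TP q γ.toFun
        ≤ ∫⁻ _ : UnitAddCircle × UnitAddCircle, ropelength γ.toFun ^ q := by
          refine lintegral_mono_ae ?_
          filter_upwards [ae_fst_ne_snd] with p hp
          rw [γ.one_div_tpRadius_rpow hp, ropelength_eq]
          exact ENNReal.rpow_le_rpow (γ.ofReal_tpCurvature_le hp) hq.le
      _ = ropelength γ.toFun ^ q := by rw [lintegral_const, volume_univ_circle_prod, mul_one]
  calc TP q γ.toFun ^ (1 / q) ≤ (ropelength γ.toFun ^ q) ^ (1 / q) :=
        ENNReal.rpow_le_rpow h (by positivity)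
    _ = ropelength γ.toFun := by rw [one_div, ENNReal.rpow_rpow_inv hq.ne']

/-! ### Joint continuity and the liminf inequality -/

theorem continuous_jet : Continuous jet := by
  rw [continuous_iff_continuousAt]
  intro γ
  refine ContinuousAt.prodMk ?_ ?_ <;>
  · rw [ContinuousAt, tendsto_iff_dist_tendsto_zero]
    refine squeeze_zero (fun _ => dist_nonneg) (fun β => ?_)
      (tendsto_iff_dist_tendsto_zero.1 (tendsto_id (x := 𝓝 γ)))
    change _ ≤ c1Norm (β.toFun - γ.toFun)
    rw [c1Norm_sub]
    first
      | exact le_add_of_nonneg_right dist_nonneg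
      | exact le_add_of_nonneg_left dist_nonneg

theorem continuous_eval_toFun : Continuous fun x : C11ia × UnitAddCircle => x.1.toFun x.2 :=
  ContinuousEval.continuous_eval.comp
    ((continuous_fst.comp (continuous_jet.comp continuous_fst)).prodMk continuous_snd)

theorem continuous_eval_curveDeriv :
    Continuous fun x : C11ia × UnitAddCircle => curveDeriv x.1.toFun x.2 :=
  ContinuousEval.continuous_eval.comp
    ((continuous_snd.comp (continuous_jet.comp continuous_fst)).prodMk continuous_snd)

theorem continuousAt_tpCurvature {s t : UnitAddCircle} (hst : s ≠ t) :
    ContinuousAt (fun x : C11ia × UnitAddCircle × UnitAddCircle =>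
      tpCurvature x.1.toFun x.2.1 x.2.2) (γ, s, t) := by
  have hne : γ.toFun t - γ.toFun s ≠ 0 := sub_ne_zero.2 (γ.injective.ne hst.symm)
  have h1 : Continuous fun x : C11ia × UnitAddCircle × UnitAddCircle => x.1.toFun x.2.1 :=
    continuous_eval_toFun.comp (by fun_prop : Continuous
      fun x : C11ia × UnitAddCircle × UnitAddCircle => (x.1, x.2.1))
  have h2 : Continuous fun x : C11ia × UnitAddCircle × UnitAddCircle => x.1.toFun x.2.2 :=
    continuous_eval_toFun.comp (by fun_prop : Continuous
      fun x : C11ia × UnitAddCircle × UnitAddCircle => (x.1, x.2.2))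
  have h3 : Continuous fun x : C11ia × UnitAddCircle × UnitAddCircle =>
      curveDeriv x.1.toFun x.2.1 :=
    continuous_eval_curveDeriv.comp (by fun_prop : Continuous
      fun x : C11ia × UnitAddCircle × UnitAddCircle => (x.1, x.2.1))
  unfold tpCurvature
  refine ContinuousAt.div (Continuous.continuousAt ?_) (Continuous.continuousAt ?_)
    (pow_ne_zero 2 (norm_ne_zero_iff.2 hne))
  · exact continuous_const.mul
      (continuous_rejection.comp (h3.prodMk (h2.sub h1))).norm
  · exact (h2.sub h1).norm.pow 2

end C11ia

theorem tendsto_const_rpow_one_div {ι : Type*} {l : Filter ι} {k : ι → ℝ}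
    (hk : Tendsto k l atTop) {m : ℝ≥0∞} (h0 : m ≠ 0) (htop : m ≠ ⊤) :
    Tendsto (fun i => m ^ (1 / k i)) l (𝓝 1) := by
  have hpos : 0 < m.toReal := ENNReal.toReal_pos h0 htop
  have hz : Tendsto (fun i => 1 / k i) l (𝓝 0) := tendsto_const_nhds.div_atTop hk
  have h1 : Tendsto (fun i => m.toReal ^ (1 / k i)) l (𝓝 1) := by
    have := (Real.continuousAt_const_rpow (a := m.toReal) (b := 0) hpos.ne').tendsto.comp hz
    rwa [Real.rpow_zero] at this
  have h2 := ENNReal.tendsto_ofReal h1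
  rw [ENNReal.ofReal_one] at h2
  refine h2.congr fun i => ?_
  rw [← ENNReal.ofReal_rpow_of_pos hpos, ENNReal.ofReal_toReal htop]

namespace C11ia

/-- The general filter serves both real exponents with a fixed curve and sequences of curves. -/
theorem ropelength_le_liminf {ι : Type*} {l : Filter ι} {u : ι → C11ia} {γ : C11ia}
    (hu : Tendsto u l (𝓝 γ)) {k : ι → ℝ} (hk : Tendsto k l atTop) :
    ropelength γ.toFun ≤ liminf (fun i => TP (k i) (u i).toFun ^ (1 / k i)) l := by
  rcases l.eq_or_neBot with rfl | hl
  · simp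
  refine le_of_forall_lt_imp_le_of_dense fun M hM => ?_
  obtain ⟨s, t, hst, hlt⟩ := γ.exists_lt_tpCurvature hM
  have hMtop : M ≠ ⊤ := hlt.ne_top
  have hev : ∀ᶠ x : C11ia × UnitAddCircle × UnitAddCircle in 𝓝 (γ, s, t),
      M < ENNReal.ofReal (tpCurvature x.1.toFun x.2.1 x.2.2) ∧ x.2.1 ≠ x.2.2 := by
    refine ((ENNReal.continuous_ofReal.continuousAt.comp
      (γ.continuousAt_tpCurvature hst)).eventually (lt_mem_nhds hlt)).and ?_
    have hc : ContinuousAt (fun x : C11ia × UnitAddCircle × UnitAddCircle => x.2) (γ, s, t) :=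
      continuousAt_snd
    exact hc.eventually ((isOpen_ne_fun continuous_fst continuous_snd).mem_nhds hst)
  -- Splitting the neighbourhood makes the parameter set independent of the curve, so its measure
  -- stays fixed along the sequence.
  rw [nhds_prod_eq, eventually_prod_iff] at hev
  obtain ⟨V, hV, U, hU, hVU⟩ := hev
  obtain ⟨O, hOU, hO, hstO⟩ := mem_nhds_iff.1 hU
  have hm0 : volume O ≠ 0 := (hO.measure_pos volume ⟨_, hstO⟩).ne'
  have hmtop : volume O ≠ ⊤ := ((measure_mono (Set.subset_univ O)).trans_lt
    (volume_univ_circle_prod.trans_lt ENNReal.one_lt_top)).ne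
  have hlim : Tendsto (fun i => M * volume O ^ (1 / k i)) l (𝓝 M) := by
    have := ENNReal.Tendsto.const_mul (tendsto_const_rpow_one_div hk hm0 hmtop)
      (a := M) (.inr hMtop)
    rwa [mul_one] at this
  rw [← hlim.liminf_eq]
  refine liminf_le_liminf ?_
  filter_upwards [hu.eventually hV, hk.eventually_gt_atTop 0] with i hi hki
  have hTP : M ^ k i * volume O ≤ TP (k i) (u i).toFun := by
    rw [← setLIntegral_const]
    refine (setLIntegral_mono' hO.measurableSet fun p hp => ?_).trans
      (setLIntegral_le_lintegral O _)
    obtain ⟨h1, h2⟩ := hVU hi (hOU hp)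
    rw [(u i).one_div_tpRadius_rpow h2]
    exact ENNReal.rpow_le_rpow h1.le hki.le
  calc M * volume O ^ (1 / k i) = (M ^ k i * volume O) ^ (1 / k i) := by
        rw [ENNReal.mul_rpow_of_nonneg _ _ (by positivity), one_div, ENNReal.rpow_rpow_inv hki.ne']
    _ ≤ _ := ENNReal.rpow_le_rpow hTP (by positivity)

theorem limsup_TP_rpow_le (γ : C11ia) {ι : Type*} {l : Filter ι} {k : ι → ℝ}
    (hk : Tendsto k l atTop) :
    limsup (fun i => TP (k i) γ.toFun ^ (1 / k i)) l ≤ ropelength γ.toFun :=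
  limsup_le_of_le (h := (hk.eventually_gt_atTop 0).mono fun _ hi => γ.TP_rpow_le hi)

end C11ia

end TangentPoint

theorem lemma5p1 :
    (∀ γ : TangentPoint.C11ia,
      Tendsto (fun k : ℝ => TangentPoint.TP k γ.toFun ^ (1 / k)) atTop
        (𝓝 (TangentPoint.ropelength γ.toFun))) ∧
    (∀ k : ℕ → ℝ, Tendsto k atTop atTop →
      TangentPoint.GammaConverges
        (fun (n : ℕ) (γ : TangentPoint.C11ia) => TangentPoint.TP (k n) γ.toFun ^ (1 / k n))
        (fun γ : TangentPoint.C11ia => TangentPoint.ropelength γ.toFun)) := by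
  refine ⟨fun γ => ?_, fun k hk => ⟨fun γ u hu => ?_, fun γ => ?_⟩⟩
  · exact tendsto_of_le_liminf_of_limsup_le
      (TangentPoint.C11ia.ropelength_le_liminf tendsto_const_nhds tendsto_id)
      (γ.limsup_TP_rpow_le tendsto_id)
  · exact TangentPoint.C11ia.ropelength_le_liminf hu hk
  · exact ⟨fun _ => γ, tendsto_const_nhds, γ.limsup_TP_rpow_le hk⟩
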